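/- **Setting.** Let $\Lambda=\{0,\dots,L\}^2\subset\mathbb Z^2$, let $\partial^-\Lambda$ be the set of sites of $\Lambda$ having a nearest neighbour outside $\Lambda$, let $\Lambda_0=\Lambda\setminus\partial^-\Lambda$, and let $\mathcal X=\{0,1\}^\Lambda$. For $\eta\in\mathcal X$ let $$H(\eta)=-U_1\sum_{\{x,y\}\text{ horizontal bond of }\Lambda_0}\eta(x)\eta(y)-U_2\sum_{\{x,y\}\text{ vertical bond of }\Lambda_0}\eta(x)\eta(y)+\Delta\sum_{x\in\Lambda}\eta(x),$$ where bonds are unoriented and join nearest neighbours. Assume $$U_1>2U_2,\qquad \varepsilon:=U_1+U_2-\Delta\in(0,U_2/100],\qquad U_2/\varepsilon\notin\mathbb Z .$$ The local Kawasaki dynamics at inverse temperature $\beta>0$ is the Markov chain on $\mathcal X$ in which, for each oriented nearest-neighbour bond $b=(x\to y)$ with at least one end in $\Lambda$, $T_b\eta$ is obtained from $\eta$ by exchanging $\eta(x)$ and $\eta(y)$ if $x,y\in\Lambda$, by setting $\eta(x)=0$ if $y\notin\Lambda$, and by setting $\eta(y)=1$ if $x\notin\Lambda$. With $N$ the number of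 these bonds, its transition probabilities are $P(\eta,\eta')=N^{-1}e^{-\beta\max\{H(\eta')-H(\eta),0\}}$ if $\eta'\ne\eta$ and $\eta'=T_b\eta$ for some $b$, $P(\eta,\eta')=0$ for all other $\eta'\neq\eta$, and $P(\eta,\eta)=1-\sum_{\eta'\ne\eta}P(\eta,\eta')$. A path $\omega:\eta\to\eta'$ is a finite sequence of configurations from $\eta$ to $\eta'$ whose successive terms have positive transition probability. The stability level of $\eta$ is $$V_\eta=\min_{\eta':\,H(\eta')<H(\eta)}\ \min_{\omega:\eta\to\eta'}\ \max_{\xi\in\omega}H(\xi)-H(\eta)$$ ($V_\eta=\infty$ if no $\eta'$ has $H(\eta')<H(\eta)$), and $\mathcal X_V=\{\eta:V_\eta>V\}$. Let $\underline 0$ be the empty configuration and $\underline 1$ the configuration that is full in $\Lambda_0$ and empty in $\partial^-\Lambda$. Let $\ell_2^*=\lfloor U_2/\varepsilon\rfloor+1$, let $H(\mathcal R(l_1,l_2))=U_1l_2+U_2l_1-\varepsilon l_1l_2$, and let $$\Gamma=H(\mathcal R(2\ell_2^*-2,\ell_2^*))+\varepsilon(\ell_2^*-1)+\Delta .$$ Call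 $\eta$ a *supercritical strip configuration* if its set of particles is a union of complete rows of $\Lambda_0$ in which every row belongs to a block of $\ell_2^*$ consecutive occupied rows. **Proposition.** One has $2\Delta-U_1<\Gamma$ and $V^*:=2\Delta-U_2<\Gamma$. There is $L_0$, depending only on $U_1,U_2,\Delta$, such that for all $L\ge L_0$ and all $\beta>0$: 1. $\mathcal X_{V^*}\subseteq\{\underline 0,\underline 1\}$. 2. Every $\eta\in\mathcal X_{2\Delta-U_1}\setminus\{\underline 0,\underline 1\}$ is a supercritical strip configuration. 3. For every $\eta\ne\underline 0,\underline 1$ there are $\eta'\in\mathcal X$ and a path $\omega:\eta\to\eta'$ such that $H(\eta')<H(\eta)$ and $$V_\eta\le\max_{\xi\in\omega}H(\xi)-H(\eta)\le V^*;$$ if $\eta$ is not a supercritical strip configuration, the upper bound $V^*$ can here be replaced by $2\Delta-U_1$. -/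

import Mathlib

noncomputable section

namespace Kawasaki

/-! ### Energy landscapes: paths, communication heights, stability levels

`X` is the state space, `P` the transition matrix and `H` the energy. -/

/-- `ω` is a path from `η` to `η'`: a finite sequence with first term `η`, last term `η'`, whose
consecutive terms have positive transition probability. -/
def IsPath {X : Type*} (P : X → X → ℝ) (ω : List X) (η η' : X) : Prop :=
  ω.head? = some η ∧ ω.getLast? = some η' ∧ ω.IsChain (fun ξ ζ => 0 < P ξ ζ)

/-- The maximum of the energy along a (nonempty) finite sequence of states. -/
def pathHeight {X : Type*} (H : X → ℝ) (ω : List X) : EReal :=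
  ⨆ ξ ∈ ω, (H ξ : EReal)

/-- The communication height `Φ(η, η')`: the minimum over all paths from `η` to `η'` of the maximum
of the energy along the path. -/
def commHeight {X : Type*} (P : X → X → ℝ) (H : X → ℝ) (η η' : X) : EReal :=
  ⨅ (ω : List X) (_ : IsPath P ω η η'), pathHeight H ω

/-- The set `I_ζ` of states with energy strictly below that of `ζ`. -/
def lowerStates {X : Type*} (H : X → ℝ) (ζ : X) : Set X :=
  {η | H η < H ζ}

/-- The stability level `V_ζ = Φ(ζ, I_ζ) - H(ζ)`; it is `⊤` if `I_ζ` is empty. -/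
def stabilityLevel {X : Type*} (P : X → X → ℝ) (H : X → ℝ) (ζ : X) : EReal :=
  (⨅ η ∈ lowerStates H ζ, commHeight P H ζ η) - (H ζ : EReal)

/-- The set `X_V` of `V`-irreducible states. -/
def irreducibleStates {X : Type*} (P : X → X → ℝ) (H : X → ℝ) (V : ℝ) : Set X :=
  {η | (V : EReal) < stabilityLevel P H η}

/-! ### The box -/

/-- Nearest neighbours in `ℤ²` (points at Euclidean distance one). -/
def NN (x y : ℤ × ℤ) : Prop :=
  |y.1 - x.1| + |y.2 - x.2| = 1

instance (x y : ℤ × ℤ) : Decidable (NN x y) :=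
  inferInstanceAs (Decidable (|y.1 - x.1| + |y.2 - x.2| = 1))

/-- The box `Λ = {0, …, L}²`. -/
def box (L : ℕ) : Finset (ℤ × ℤ) :=
  Finset.Icc 0 (L : ℤ) ×ˢ Finset.Icc 0 (L : ℤ)

open Classical in
/-- The interior boundary `∂⁻Λ`. -/
def innerBoundary (L : ℕ) : Finset (ℤ × ℤ) :=
  (box L).filter fun x => ∃ y, y ∉ box L ∧ NN x y

/-- The interior `Λ₀ = Λ \ ∂⁻Λ`. -/
def interiorBox (L : ℕ) : Finset (ℤ × ℤ) :=
  box L \ innerBoundary L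

/-- A site of the box. -/
abbrev Site (L : ℕ) : Type := {x : ℤ × ℤ // x ∈ box L}

/-- Configurations `η ∈ {0,1}^Λ`. -/
abbrev Config (L : ℕ) : Type := Site L → Fin 2

/-- The empty configuration. -/
def emptyConfig (L : ℕ) : Config L := fun _ => 0

/-- The configuration that is full in `Λ₀` and empty in `Λ \ Λ₀`. -/
def fullConfig (L : ℕ) : Config L := fun x => if x.1 ∈ interiorBox L then 1 else 0

/-! ### The Hamiltonian -/

/-- The occupation number of a site, as a real number. -/
def occ {L : ℕ} (η : Config L) (x : Site L) : ℝ := ((η x : ℕ) : ℝ)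

/-- Sum of `η(x) η(y)` over the nearest-neighbour bonds `{x, y}` of `Λ₀` with `y = x + e`.
For `e = (1, 0)` (resp. `e = (0, 1)`) each unoriented horizontal (resp. vertical) bond of `Λ₀`
is counted exactly once. -/
def bondSum {L : ℕ} (e : ℤ × ℤ) (η : Config L) : ℝ :=
  ∑ x : Site L, ∑ y : Site L,
    if x.1 ∈ interiorBox L ∧ y.1 ∈ interiorBox L ∧ y.1 = x.1 + e then occ η x * occ η y else 0

/-- The Hamiltonian: binding energy `-U₁` for each horizontal and `-U₂` for each vertical occupied
bond of `Λ₀`, and activation energy `Δ` for each particle in `Λ`. -/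
def hamiltonian (U₁ U₂ Δ : ℝ) {L : ℕ} (η : Config L) : ℝ :=
  -U₁ * bondSum (1, 0) η - U₂ * bondSum (0, 1) η + Δ * ∑ x : Site L, occ η x

/-! ### The local Kawasaki dynamics -/

/-- The sites of `ℤ²` at coordinates `-1, …, L + 1`. They include all neighbours of `Λ`. -/
def enlargedBox (L : ℕ) : Finset (ℤ × ℤ) :=
  Finset.Icc (-1) ((L : ℤ) + 1) ×ˢ Finset.Icc (-1) ((L : ℤ) + 1)

/-- The oriented bonds: ordered pairs of nearest neighbours, either both in `Λ`, or going from
`∂⁻Λ` to the outside of `Λ`, or going from the outside of `Λ` to `∂⁻Λ`. -/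
def orientedBonds (L : ℕ) : Finset ((ℤ × ℤ) × (ℤ × ℤ)) :=
  (enlargedBox L ×ˢ enlargedBox L).filter fun b => NN b.1 b.2 ∧
    ((b.1 ∈ box L ∧ b.2 ∈ box L) ∨ (b.1 ∈ innerBoundary L ∧ b.2 ∉ box L) ∨
      (b.1 ∉ box L ∧ b.2 ∈ innerBoundary L))

/-- The configuration `T_b η`: exchange the occupation numbers along a bond inside `Λ`, annihilate
a particle along an outgoing bond, create a particle along an incoming bond. -/
def moveAlong {L : ℕ} (b : (ℤ × ℤ) × (ℤ × ℤ)) (η : Config L) : Config L :=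
  if hx : b.1 ∈ box L then
    if hy : b.2 ∈ box L then η ∘ Equiv.swap (⟨b.1, hx⟩ : Site L) ⟨b.2, hy⟩
    else Function.update η ⟨b.1, hx⟩ 0
  else
    if hy : b.2 ∈ box L then Function.update η ⟨b.2, hy⟩ 1
    else η

open Classical in
/-- The off-diagonal Metropolis rates at inverse temperature `β`. -/
def jumpProb (U₁ U₂ Δ β : ℝ) {L : ℕ} (η η' : Config L) : ℝ :=
  if ∃ b ∈ orientedBonds L, η' = moveAlong b η then
    ((orientedBonds L).card : ℝ)⁻¹ *
      Real.exp (-β * max (hamiltonian U₁ U₂ Δ η' - hamiltonian U₁ U₂ Δ η) 0)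
  else 0

open Classical in
/-- The transition matrix of the local Kawasaki dynamics at inverse temperature `β`. -/
def transProb (U₁ U₂ Δ β : ℝ) {L : ℕ} (η η' : Config L) : ℝ :=
  if η = η' then 1 - ∑ ζ ∈ Finset.univ.filter (fun ζ : Config L => ζ ≠ η), jumpProb U₁ U₂ Δ β η ζ
  else jumpProb U₁ U₂ Δ β η η'

/-! ### The critical length and the critical energy -/

/-- `ε = U₁ + U₂ - Δ`. -/
def eps (U₁ U₂ Δ : ℝ) : ℝ := U₁ + U₂ - Δ

/-- The critical vertical length `ℓ₂*`: the integer part of `U₂ / ε`, plus one. -/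
def critLength (U₁ U₂ Δ : ℝ) : ℕ := ⌊U₂ / eps U₁ U₂ Δ⌋₊ + 1

/-- The energy of a rectangular droplet with horizontal side `l₁` and vertical side `l₂`. -/
def rectEnergy (U₁ U₂ Δ l₁ l₂ : ℝ) : ℝ := U₁ * l₂ + U₂ * l₁ - eps U₁ U₂ Δ * l₁ * l₂

/-- The energy `Γ` of the critical droplets: that of a rectangle with sides `2ℓ₂* - 2` and `ℓ₂*`,
plus `ε (ℓ₂* - 1) + Δ`. -/
def critEnergy (U₁ U₂ Δ : ℝ) : ℝ :=
  rectEnergy U₁ U₂ Δ (2 * (critLength U₁ U₂ Δ : ℝ) - 2) (critLength U₁ U₂ Δ) +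
    eps U₁ U₂ Δ * ((critLength U₁ U₂ Δ : ℝ) - 1) + Δ

/-! ### Horizontal strips -/

/-- `η` is a union of complete rows of `Λ₀` which come in blocks of at least `l` consecutive rows:
it is empty on `∂⁻Λ`, constant on each row of `Λ₀`, and each occupied row belongs to a
block of `l` consecutive occupied rows. -/
def IsStripConfig {L : ℕ} (l : ℕ) (η : Config L) : Prop :=
  (∀ x : Site L, x.1 ∈ innerBoundary L → η x = 0) ∧
  (∀ x y : Site L, x.1 ∈ interiorBox L → y.1 ∈ interiorBox L → x.1.2 = y.1.2 → η x = η y) ∧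
  (∀ x : Site L, η x = 1 → ∃ j : ℤ, j ≤ x.1.2 ∧ x.1.2 < j + l ∧
    ∀ i : ℤ, j ≤ i → i < j + l → ∃ y : Site L, y.1.2 = i ∧ η y = 1)

end Kawasaki

end

noncomputable section

namespace Kawasaki

/-! ### Geometry of the box -/

theorem mem_box {L : ℕ} {x y : ℤ} : (x, y) ∈ box L ↔ (0 ≤ x ∧ x ≤ L) ∧ 0 ≤ y ∧ y ≤ L := by
  simp [box]

theorem mem_innerBoundary {L : ℕ} {x y : ℤ} :
    (x, y) ∈ innerBoundary L ↔
      ((0 ≤ x ∧ x ≤ L) ∧ 0 ≤ y ∧ y ≤ L) ∧ (x = 0 ∨ x = L ∨ y = 0 ∨ y = L) := by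
  simp only [innerBoundary, Finset.mem_filter, mem_box, and_congr_right_iff]
  intro h
  constructor
  · rintro ⟨⟨u, v⟩, hb, hn⟩
    rw [mem_box] at hb
    simp only [NN] at hn
    grind
  · intro hb
    rcases hb with rfl | rfl | rfl | rfl
    · exact ⟨(-1, y), by simp [mem_box], by simp [NN]⟩
    · exact ⟨(L + 1, y), by simp [mem_box], by simp [NN]⟩
    · exact ⟨(x, -1), by simp [mem_box], by simp [NN]⟩
    · exact ⟨(x, L + 1), by simp [mem_box], by simp [NN]⟩

theorem mem_interiorBox {L : ℕ} {x y : ℤ} :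
    (x, y) ∈ interiorBox L ↔ (1 ≤ x ∧ x < L) ∧ 1 ≤ y ∧ y < L := by
  simp only [interiorBox, Finset.mem_sdiff, mem_innerBoundary, mem_box]
  omega

theorem interiorBox_subset_box {L : ℕ} : interiorBox L ⊆ box L := Finset.sdiff_subset

theorem NN.symm {x y : ℤ × ℤ} (h : NN x y) : NN y x := by
  simp only [NN] at *
  rwa [abs_sub_comm, abs_sub_comm x.2]

/-- The configuration whose set of particles is `S ∩ Λ`. -/
def cfg (L : ℕ) (S : Finset (ℤ × ℤ)) : Config L := fun x => if x.1 ∈ S then 1 else 0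

theorem exists_cfg {L : ℕ} (η : Config L) : ∃ S ⊆ box L, η = cfg L S := by
  classical
  refine ⟨(box L).attach.filter (fun x => η x = 1) |>.map (Function.Embedding.subtype _), ?_, ?_⟩
  · intro x
    simp only [Finset.mem_map, Finset.mem_filter]
    rintro ⟨y, -, rfl⟩
    exact y.2
  · funext x
    simp only [cfg, Finset.mem_map, Finset.mem_filter, Finset.mem_attach, true_and,
      Function.Embedding.coe_subtype]
    have : (∃ a : Site L, η a = 1 ∧ a.1 = x.1) ↔ η x = 1 :=
      ⟨fun ⟨a, ha, hx⟩ => Subtype.ext hx ▸ ha, fun h => ⟨x, h, rfl⟩⟩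
    rw [if_congr this rfl rfl]
    split_ifs <;> omega

/-! ### Energy differences -/

/-- The indicator function of the particles in `Λ₀`. -/
def bulkOcc (L : ℕ) (S : Finset (ℤ × ℤ)) (z : ℤ × ℤ) : ℝ :=
  if z ∈ S ∧ z ∈ interiorBox L then 1 else 0

theorem bulkOcc_nonneg (L : ℕ) (S z) : 0 ≤ bulkOcc L S z := by
  unfold bulkOcc; split_ifs <;> norm_num

theorem bulkOcc_le_one (L : ℕ) (S z) : bulkOcc L S z ≤ 1 := by
  unfold bulkOcc; split_ifs <;> norm_num

theorem bulkOcc_of_notMem {L : ℕ} {S z} (h : z ∉ S) : bulkOcc L S z = 0 := by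
  simp [bulkOcc, h]

/-- The binding energy of a particle at `z` with the particles of `S`. -/
def binding (U₁ U₂ : ℝ) (L : ℕ) (S : Finset (ℤ × ℤ)) (z : ℤ × ℤ) : ℝ :=
  if z ∈ interiorBox L then
    U₁ * (bulkOcc L S (z + (1, 0)) + bulkOcc L S (z - (1, 0))) +
      U₂ * (bulkOcc L S (z + (0, 1)) + bulkOcc L S (z - (0, 1)))
  else 0

theorem occ_cfg {L : ℕ} (S : Finset (ℤ × ℤ)) (x : Site L) :
    occ (cfg L S) x = if x.1 ∈ S then 1 else 0 := by
  unfold occ cfg; split_ifs <;> simp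

theorem bondSum_cfg {L : ℕ} (e : ℤ × ℤ) (S : Finset (ℤ × ℤ)) :
    bondSum e (cfg L S) = ∑ x ∈ box L, bulkOcc L S x * bulkOcc L S (x + e) := by
  unfold bondSum
  have key : ∀ x y : Site L,
      (if x.1 ∈ interiorBox L ∧ y.1 ∈ interiorBox L ∧ y.1 = x.1 + e then
        occ (cfg L S) x * occ (cfg L S) y else 0) =
      if y.1 = x.1 + e then bulkOcc L S x.1 * bulkOcc L S y.1 else 0 := by
    intro x y
    rw [occ_cfg, occ_cfg]
    unfold bulkOcc
    by_cases h1 : x.1 ∈ interiorBox L <;> by_cases h2 : y.1 ∈ interiorBox L <;> simp [h1, h2]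
  simp_rw [key]
  rw [← Finset.sum_coe_sort (box L) (fun x => bulkOcc L S x * bulkOcc L S (x + e))]
  refine Finset.sum_congr rfl fun x _ => ?_
  rw [Finset.sum_coe_sort (box L)
    (fun y => if y = x.1 + e then bulkOcc L S x.1 * bulkOcc L S y else 0), Finset.sum_ite_eq']
  split_ifs with h
  · rfl
  · have : x.1 + e ∉ interiorBox L := fun h' => h (interiorBox_subset_box h')
    simp [bulkOcc, this]

theorem bulkOcc_insert {L : ℕ} {S : Finset (ℤ × ℤ)} {z : ℤ × ℤ} (hz : z ∉ S) (x : ℤ × ℤ) :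
    bulkOcc L (insert z S) x =
      bulkOcc L S x + if x = z then (if z ∈ interiorBox L then 1 else 0) else 0 := by
  unfold bulkOcc
  by_cases h : x = z
  · subst h; simp [hz]
  · simp [h]

theorem bondSum_insert {L : ℕ} {S : Finset (ℤ × ℤ)} {z e : ℤ × ℤ} (hz : z ∉ S) (he : e ≠ 0) :
    bondSum e (cfg L (insert z S)) = bondSum e (cfg L S) +
      if z ∈ interiorBox L then bulkOcc L S (z + e) + bulkOcc L S (z - e) else 0 := by
  simp only [bondSum_cfg, bulkOcc_insert hz]
  by_cases hI : z ∈ interiorBox L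
  · simp only [hI, if_true]
    have hb := interiorBox_subset_box hI
    have key : ∀ x ∈ box L, (bulkOcc L S x + if x = z then (1 : ℝ) else 0) *
        (bulkOcc L S (x + e) + if x + e = z then 1 else 0) =
        bulkOcc L S x * bulkOcc L S (x + e) + ((if x = z then bulkOcc L S (x + e) else 0) +
          if x = z - e then bulkOcc L S x else 0) := by
      intro x _
      by_cases h1 : x = z
      · subst h1
        have : ¬ x = x - e := by simpa [eq_sub_iff_add_eq] using he
        simp [he, this, bulkOcc_of_notMem hz]
      · simp only [h1, if_false, eq_sub_iff_add_eq]
        split_ifs <;> ring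
    rw [Finset.sum_congr rfl key, Finset.sum_add_distrib, Finset.sum_add_distrib,
      Finset.sum_ite_eq', Finset.sum_ite_eq', if_pos hb]
    -- The site `z - e` may lie outside the box, but then its bulk occupation vanishes.
    split_ifs with h
    · rfl
    · have : z - e ∉ interiorBox L := fun h' => h (interiorBox_subset_box h')
      simp [bulkOcc, this]
  · simp [hI]

variable {U₁ U₂ Δ : ℝ} {L : ℕ}

theorem hamiltonian_insert {S : Finset (ℤ × ℤ)} {z : ℤ × ℤ} (hz : z ∉ S) (hb : z ∈ box L) :
    hamiltonian U₁ U₂ Δ (cfg L (insert z S)) =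
      hamiltonian U₁ U₂ Δ (cfg L S) + Δ - binding U₁ U₂ L S z := by
  have h3 : ∑ x : Site L, occ (cfg L (insert z S)) x = ∑ x : Site L, occ (cfg L S) x + 1 := by
    have : ∀ x : Site L, occ (cfg L (insert z S)) x =
        occ (cfg L S) x + if x = ⟨z, hb⟩ then 1 else 0 := by
      intro x
      rw [occ_cfg, occ_cfg]
      by_cases h : x = ⟨z, hb⟩
      · subst h; simp [hz]
      · have : x.1 ≠ z := fun h' => h (Subtype.ext h')
        simp [h, this]
    simp [this, Finset.sum_add_distrib]
  rw [hamiltonian, bondSum_insert hz (by simp), bondSum_insert hz (by simp), h3, hamiltonian,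
    binding]
  split_ifs <;> ring

theorem binding_insert_self (S : Finset (ℤ × ℤ)) (z : ℤ × ℤ) :
    binding U₁ U₂ L (insert z S) z = binding U₁ U₂ L S z := by
  have h : ∀ e : ℤ × ℤ, e ≠ 0 → bulkOcc L (insert z S) (z + e) = bulkOcc L S (z + e) := by
    intro e he
    simp [bulkOcc, he]
  simp only [binding, sub_eq_add_neg]
  rw [h _ (by simp), h _ (by simp), h _ (by simp), h _ (by simp)]

theorem hamiltonian_erase {S : Finset (ℤ × ℤ)} {z : ℤ × ℤ} (hz : z ∈ S) (hb : z ∈ box L) :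
    hamiltonian U₁ U₂ Δ (cfg L (S.erase z)) =
      hamiltonian U₁ U₂ Δ (cfg L S) - Δ + binding U₁ U₂ L S z := by
  have h := hamiltonian_insert (U₁ := U₁) (U₂ := U₂) (Δ := Δ) (Finset.notMem_erase z S) hb
  have h' := binding_insert_self (U₁ := U₁) (U₂ := U₂) (L := L) (S.erase z) z
  rw [Finset.insert_erase hz] at h h'
  linarith

/-- The range of parameters: strong anisotropy and small supersaturation. -/
structure Regime (U₁ U₂ Δ : ℝ) : Prop where
  anisotropic : 2 * U₂ < U₁
  eps_pos : 0 < U₁ + U₂ - Δ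
  eps_le : U₁ + U₂ - Δ ≤ U₂ / 100

theorem Regime.U₂_pos (h : Regime U₁ U₂ Δ) : 0 < U₂ := by
  linarith [h.eps_pos, h.eps_le]

theorem binding_le (h : Regime U₁ U₂ Δ) (S : Finset (ℤ × ℤ)) (x y : ℤ) :
    binding U₁ U₂ L S (x, y) ≤
      U₁ * (bulkOcc L S (x + 1, y) + bulkOcc L S (x - 1, y)) +
      U₂ * (bulkOcc L S (x, y + 1) + bulkOcc L S (x, y - 1)) := by
  have h2 := h.U₂_pos
  have h1 : 0 < U₁ := by linarith [h.anisotropic]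
  unfold binding
  split_ifs with hI
  · simp
  · have := bulkOcc_nonneg L S
    exact add_nonneg (mul_nonneg h1.le (add_nonneg (this _) (this _)))
      (mul_nonneg h2.le (add_nonneg (this _) (this _)))

theorem binding_nonneg (h : Regime U₁ U₂ Δ) (S : Finset (ℤ × ℤ)) (z : ℤ × ℤ) :
    0 ≤ binding U₁ U₂ L S z := by
  have h2 := h.U₂_pos
  have h1 : 0 < U₁ := by linarith [h.anisotropic]
  have := bulkOcc_nonneg L S
  unfold binding
  split_ifs with hI
  · exact add_nonneg (mul_nonneg h1.le (add_nonneg (this _) (this _)))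
      (mul_nonneg h2.le (add_nonneg (this _) (this _)))
  · rfl

theorem binding_le_full (h : Regime U₁ U₂ Δ) (S : Finset (ℤ × ℤ)) (z : ℤ × ℤ) :
    binding U₁ U₂ L S z ≤ 2 * U₁ + 2 * U₂ := by
  have h2 := h.U₂_pos
  have h1 : 0 < U₁ := by linarith [h.anisotropic]
  have h3 := binding_le (L := L) h S z.1 z.2
  have := bulkOcc_le_one L S
  nlinarith [this (z.1 + 1, z.2), this (z.1 - 1, z.2), this (z.1, z.2 + 1), this (z.1, z.2 - 1)]

theorem binding_le_corner (h : Regime U₁ U₂ Δ) {S : Finset (ℤ × ℤ)} {x y : ℤ}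
    (hx : (x + 1, y) ∉ S) (hy : (x, y + 1) ∉ S) :
    binding U₁ U₂ L S (x, y) ≤ U₁ + U₂ := by
  have h2 := h.U₂_pos
  have h1 : 0 < U₁ := by linarith [h.anisotropic]
  have h3 := binding_le (L := L) h S x y
  rw [bulkOcc_of_notMem hx, bulkOcc_of_notMem hy] at h3
  have := bulkOcc_le_one L S
  nlinarith [this (x - 1, y), this (x, y - 1)]

theorem binding_le_horizontal (h : Regime U₁ U₂ Δ) {S : Finset (ℤ × ℤ)} {x y : ℤ}
    (hx : (x + 1, y) ∉ S) (hy : (x, y + 1) ∉ S) (hy' : (x, y - 1) ∉ S) :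
    binding U₁ U₂ L S (x, y) ≤ U₁ := by
  have h1 : 0 < U₁ := by linarith [h.anisotropic, h.U₂_pos]
  have h3 := binding_le (L := L) h S x y
  rw [bulkOcc_of_notMem hx, bulkOcc_of_notMem hy, bulkOcc_of_notMem hy'] at h3
  have := bulkOcc_le_one L S
  nlinarith [this (x - 1, y)]

theorem horizontal_le_binding (h : Regime U₁ U₂ Δ) {S : Finset (ℤ × ℤ)} {x y s : ℤ}
    (hs : s = 1 ∨ s = -1) (hI : (x, y) ∈ interiorBox L) (hS : (x + s, y) ∈ S)
    (hSI : (x + s, y) ∈ interiorBox L) :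
    U₁ + U₂ * (bulkOcc L S (x, y + 1) + bulkOcc L S (x, y - 1)) ≤ binding U₁ U₂ L S (x, y) := by
  have h1 : 0 < U₁ := by linarith [h.anisotropic, h.U₂_pos]
  have h1' : bulkOcc L S (x + s, y) = 1 := by simp [bulkOcc, hS, hSI]
  have := bulkOcc_nonneg L S
  simp only [binding, hI, if_true, Prod.mk_add_mk, Prod.mk_sub_mk, add_zero, sub_zero]
  rcases hs with rfl | rfl
  · rw [h1']
    nlinarith [this (x - 1, y)]
  · rw [← sub_eq_add_neg] at h1'
    rw [h1']
    nlinarith [this (x + 1, y)]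

theorem vertical_le_binding (h : Regime U₁ U₂ Δ) {S : Finset (ℤ × ℤ)} {x y t : ℤ}
    (ht : t = 1 ∨ t = -1) (hI : (x, y) ∈ interiorBox L) (hT : (x, y + t) ∈ S)
    (hTI : (x, y + t) ∈ interiorBox L) :
    U₂ ≤ binding U₁ U₂ L S (x, y) := by
  have h2 := h.U₂_pos
  have h1 : 0 < U₁ := by linarith [h.anisotropic]
  have h1' : bulkOcc L S (x, y + t) = 1 := by simp [bulkOcc, hT, hTI]
  have := bulkOcc_nonneg L S
  have h3 := mul_nonneg h1.le (add_nonneg (this (x + 1, y)) (this (x - 1, y)))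
  simp only [binding, hI, if_true, Prod.mk_add_mk, Prod.mk_sub_mk, add_zero, sub_zero]
  rcases ht with rfl | rfl
  · rw [h1']
    nlinarith [this (x, y - 1)]
  · rw [← sub_eq_add_neg] at h1'
    rw [h1']
    nlinarith [this (x, y + 1)]

theorem horizontal_le_binding' (h : Regime U₁ U₂ Δ) {S : Finset (ℤ × ℤ)} {x y s : ℤ}
    (hs : s = 1 ∨ s = -1) (hI : (x, y) ∈ interiorBox L) (hS : (x + s, y) ∈ S)
    (hSI : (x + s, y) ∈ interiorBox L) : U₁ ≤ binding U₁ U₂ L S (x, y) := by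
  have h1 := horizontal_le_binding h hs hI hS hSI
  have := bulkOcc_nonneg L S
  linarith [mul_nonneg h.U₂_pos.le (add_nonneg (this (x, y + 1)) (this (x, y - 1)))]

theorem corner_le_binding (h : Regime U₁ U₂ Δ) {S : Finset (ℤ × ℤ)} {x y s t : ℤ}
    (hs : s = 1 ∨ s = -1) (ht : t = 1 ∨ t = -1) (hI : (x, y) ∈ interiorBox L)
    (hS : (x + s, y) ∈ S) (hSI : (x + s, y) ∈ interiorBox L)
    (hT : (x, y + t) ∈ S) (hTI : (x, y + t) ∈ interiorBox L) :
    U₁ + U₂ ≤ binding U₁ U₂ L S (x, y) := by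
  have h2 := h.U₂_pos
  have h1 := horizontal_le_binding h hs hI hS hSI
  have h1' : bulkOcc L S (x, y + t) = 1 := by simp [bulkOcc, hT, hTI]
  have := bulkOcc_nonneg L S
  rcases ht with rfl | rfl
  · rw [h1'] at h1
    nlinarith [this (x, y - 1)]
  · rw [← sub_eq_add_neg] at h1'
    rw [h1'] at h1
    nlinarith [this (x, y + 1)]

/-! ### Paths of bounded height -/

/-- `η'` can be reached from `η` by moves along bonds, at energies at most `h`. -/
def Reach (U₁ U₂ Δ h : ℝ) {L : ℕ} : Config L → Config L → Prop :=
  Relation.ReflTransGen fun η η' => hamiltonian U₁ U₂ Δ η ≤ h ∧ hamiltonian U₁ U₂ Δ η' ≤ h ∧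
    ∃ b ∈ orientedBonds L, η' = moveAlong b η

theorem Reach.mono {h h' : ℝ} (hh : h ≤ h') {η η' : Config L} (hr : Reach U₁ U₂ Δ h η η') :
    Reach U₁ U₂ Δ h' η η' := by
  induction hr with
  | refl => exact .refl
  | tail _ h ih => exact ih.tail ⟨h.1.trans hh, h.2.1.trans hh, h.2.2⟩

theorem transProb_pos {β : ℝ} {η η' : Config L} (hne : η ≠ η')
    (hb : ∃ b ∈ orientedBonds L, η' = moveAlong b η) : 0 < transProb U₁ U₂ Δ β η η' := by
  obtain ⟨b, hb1, hb2⟩ := hb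
  rw [transProb, if_neg hne, jumpProb, if_pos ⟨b, hb1, hb2⟩]
  have : 0 < (orientedBonds L).card := Finset.card_pos.2 ⟨b, hb1⟩
  positivity

theorem Reach.exists_path (β : ℝ) {h : ℝ} {η η' : Config L} (hr : Reach U₁ U₂ Δ h η η')
    (h' : hamiltonian U₁ U₂ Δ η' ≤ h) :
    ∃ ω, IsPath (transProb U₁ U₂ Δ β) ω η η' ∧
      pathHeight (hamiltonian U₁ U₂ Δ) ω ≤ (h : EReal) := by
  induction hr using Relation.ReflTransGen.head_induction_on with
  | refl => exact ⟨[η'], by simp [IsPath], by simpa [pathHeight] using h'⟩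
  | head hstep _ ih =>
    rename_i ζ ξ _
    obtain ⟨ω, ⟨h1, h2, h3⟩, h4⟩ := ih
    -- A move that leaves the configuration unchanged is dropped: positivity is available only for
    -- transitions between distinct states.
    by_cases hne : ζ = ξ
    · subst hne
      exact ⟨ω, ⟨h1, h2, h3⟩, h4⟩
    · obtain ⟨ω, rfl⟩ : ∃ ω', ω = ξ :: ω' := List.head?_eq_some_iff.1 h1
      refine ⟨ζ :: ξ :: ω, ⟨rfl, by simpa using h2, ?_⟩, ?_⟩
      · exact List.isChain_cons_cons.2 ⟨transProb_pos hne hstep.2.2, h3⟩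
      · simp only [pathHeight, List.mem_cons, iSup_or, iSup_sup_eq, iSup_iSup_eq_left,
          sup_le_iff, iSup_le_iff, EReal.coe_le_coe_iff] at h4 ⊢
        exact ⟨hstep.1, h4⟩

theorem cfg_insert (S : Finset (ℤ × ℤ)) {z : ℤ × ℤ} (hb : z ∈ box L) :
    Function.update (cfg L S) ⟨z, hb⟩ 1 = cfg L (insert z S) := by
  funext x
  by_cases h : x = ⟨z, hb⟩
  · subst h; simp [cfg]
  · have : x.1 ≠ z := fun h' => h (Subtype.ext h')
    simp [cfg, h, this]

theorem update_cfg_insert {S : Finset (ℤ × ℤ)} {z : ℤ × ℤ} (hz : z ∉ S) (hb : z ∈ box L) :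
    Function.update (cfg L (insert z S)) ⟨z, hb⟩ 0 = cfg L S := by
  funext x
  by_cases h : x = ⟨z, hb⟩
  · subst h; simp [cfg, hz]
  · have : x.1 ≠ z := fun h' => h (Subtype.ext h')
    simp [cfg, h, this]

theorem mem_enlargedBox {x y : ℤ} :
    (x, y) ∈ enlargedBox L ↔ (-1 ≤ x ∧ x ≤ L + 1) ∧ -1 ≤ y ∧ y ≤ L + 1 := by
  simp [enlargedBox]

theorem mem_enlargedBox_of_NN {x y : ℤ × ℤ} (hx : x ∈ box L) (h : NN x y) :
    x ∈ enlargedBox L ∧ y ∈ enlargedBox L := by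
  obtain ⟨x1, x2⟩ := x
  obtain ⟨y1, y2⟩ := y
  rw [mem_box] at hx
  rw [mem_enlargedBox, mem_enlargedBox]
  simp only [NN] at h
  grind

theorem innerBoundary_subset_box : innerBoundary L ⊆ box L := by
  classical
  exact Finset.filter_subset _ _

theorem exists_create {z : ℤ × ℤ} (hz : z ∈ innerBoundary L) (S : Finset (ℤ × ℤ)) :
    ∃ b ∈ orientedBonds L, cfg L (insert z S) = moveAlong b (cfg L S) := by
  have hz' := hz
  simp only [innerBoundary, Finset.mem_filter] at hz'
  obtain ⟨hb, y, hy, hn⟩ := hz'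
  have := mem_enlargedBox_of_NN hb hn
  refine ⟨(y, z), ?_, ?_⟩
  · simp only [orientedBonds, Finset.mem_filter, Finset.mem_product]
    exact ⟨⟨this.2, this.1⟩, hn.symm, Or.inr (Or.inr ⟨hy, hz⟩)⟩
  · simp only [moveAlong, hy, hb, dif_pos, dif_neg, not_false_eq_true]
    rw [cfg_insert]

theorem exists_annihilate {z : ℤ × ℤ} (hz : z ∈ innerBoundary L) {S : Finset (ℤ × ℤ)}
    (hS : z ∉ S) :
    ∃ b ∈ orientedBonds L, cfg L S = moveAlong b (cfg L (insert z S)) := by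
  have hz' := hz
  simp only [innerBoundary, Finset.mem_filter] at hz'
  obtain ⟨hb, y, hy, hn⟩ := hz'
  have := mem_enlargedBox_of_NN hb hn
  refine ⟨(z, y), ?_, ?_⟩
  · simp only [orientedBonds, Finset.mem_filter, Finset.mem_product]
    exact ⟨this, hn, Or.inr (Or.inl ⟨hz, hy⟩)⟩
  · simp only [moveAlong, hy, hb, dif_pos, dif_neg, not_false_eq_true]
    rw [update_cfg_insert hS]

theorem exists_swap {z z' : ℤ × ℤ} (hz : z ∈ box L) (hz' : z' ∈ box L) (hn : NN z z')
    {S : Finset (ℤ × ℤ)} (hS : z ∉ S) (hS' : z' ∉ S) :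
    ∃ b ∈ orientedBonds L, cfg L (insert z' S) = moveAlong b (cfg L (insert z S)) := by
  refine ⟨(z, z'), ?_, ?_⟩
  · simp only [orientedBonds, Finset.mem_filter, Finset.mem_product]
    exact ⟨mem_enlargedBox_of_NN hz hn, hn, Or.inl ⟨hz, hz'⟩⟩
  · simp only [moveAlong, hz, hz', dif_pos]
    funext x
    simp only [cfg, Function.comp, Equiv.swap_apply_def]
    have e1 : (x = (⟨z, hz⟩ : Site L)) ↔ x.1 = z := Subtype.ext_iff
    have e2 : (x = (⟨z', hz'⟩ : Site L)) ↔ x.1 = z' := Subtype.ext_iff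
    simp only [e1, e2, Finset.mem_insert]
    by_cases h1 : x.1 = z
    · simp only [h1, if_true, hS, hS', or_false, eq_comm]
    · by_cases h2 : x.1 = z'
      · have h3 : z' ≠ z := fun h => h1 (h2.trans h)
        simp [h2, h3]
      · simp [h1, h2]

theorem hamiltonian_insert_le (hR : Regime U₁ U₂ Δ) {S : Finset (ℤ × ℤ)} {z : ℤ × ℤ}
    (hz : z ∉ S) (hb : z ∈ box L) :
    hamiltonian U₁ U₂ Δ (cfg L (insert z S)) ≤ hamiltonian U₁ U₂ Δ (cfg L S) + Δ := by
  rw [hamiltonian_insert hz hb]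
  linarith [binding_nonneg (L := L) hR S z]

/-- `z` is joined to the boundary of the box by a nearest-neighbour chain of sites outside `S`. -/
inductive Accessible (L : ℕ) (S : Finset (ℤ × ℤ)) : ℤ × ℤ → Prop
  | boundary {z : ℤ × ℤ} : z ∈ innerBoundary L → z ∉ S → Accessible L S z
  | step {z z' : ℤ × ℤ} : Accessible L S z → NN z z' → z' ∈ box L → z' ∉ S → Accessible L S z'

theorem Accessible.notMem {S : Finset (ℤ × ℤ)} {z : ℤ × ℤ} (h : Accessible L S z) :
    z ∉ S ∧ z ∈ box L := by
  cases h with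
  | boundary h1 h2 => exact ⟨h2, innerBoundary_subset_box h1⟩
  | step _ _ h1 h2 => exact ⟨h2, h1⟩

/-- A particle is created at the boundary and walks along the chain, or does so in reverse. With the
particle anywhere on the chain the energy is at most that of `S` plus `Δ`, as its binding is
nonnegative. -/
theorem Accessible.reach (hR : Regime U₁ U₂ Δ) {S : Finset (ℤ × ℤ)} {z : ℤ × ℤ}
    (h : Accessible L S z) :
    Reach U₁ U₂ Δ (hamiltonian U₁ U₂ Δ (cfg L S) + Δ) (cfg L S) (cfg L (insert z S)) ∧
    Reach U₁ U₂ Δ (hamiltonian U₁ U₂ Δ (cfg L S) + Δ) (cfg L (insert z S)) (cfg L S) := by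
  have hΔ : 0 ≤ Δ := by linarith [hR.anisotropic, hR.eps_le, hR.U₂_pos]
  induction h with
  | boundary h1 h2 =>
    have := hamiltonian_insert_le hR h2 (innerBoundary_subset_box h1)
    exact ⟨.single ⟨by linarith, this, exists_create h1 S⟩,
      .single ⟨this, by linarith, exists_annihilate h1 h2⟩⟩
  | step h1 h2 h3 h4 ih =>
    have e1 := hamiltonian_insert_le hR h1.notMem.1 h1.notMem.2
    have e2 := hamiltonian_insert_le hR h4 h3
    exact ⟨ih.1.tail ⟨e1, e2, exists_swap h1.notMem.2 h3 h2 h1.notMem.1 h4⟩,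
      .head ⟨e2, e1, exists_swap h3 h1.notMem.2 h2.symm h4 h1.notMem.1⟩ ih.2⟩

theorem accessible_of_row {S : Finset (ℤ × ℤ)} {x y : ℤ} (hx : 0 ≤ x) (hxL : x ≤ L)
    (hy : 0 ≤ y) (hyL : y ≤ L) (hS : ∀ i, 0 ≤ i → i ≤ x → (i, y) ∉ S) :
    Accessible L S (x, y) := by
  induction x, hx using Int.leInduction with
  | base => exact .boundary (by rw [mem_innerBoundary]; omega) (hS 0 le_rfl le_rfl)
  | succ k hk ih =>
    exact .step (ih (by omega) fun i h0 h1 => hS i h0 (by omega)) (by simp [NN])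
      (by rw [mem_box]; omega) (hS _ (by omega) le_rfl)

/-- The route follows the empty row `d + 1` from the left boundary, then descends the free column.
-/
theorem accessible_of_column {S : Finset (ℤ × ℤ)} {x y d : ℤ} (hx : 0 ≤ x) (hxL : x ≤ L)
    (hy : 0 ≤ y) (hyd : y ≤ d + 1) (hdL : d + 1 ≤ L) (hrow : ∀ i, (i, d + 1) ∉ S)
    (hcol : ∀ j, y ≤ j → j ≤ d → (x, j) ∉ S) :
    Accessible L S (x, y) := by
  obtain ⟨k, hk⟩ := Int.eq_ofNat_of_zero_le (sub_nonneg.2 hyd)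
  induction k generalizing y with
  | zero =>
    obtain rfl : y = d + 1 := by simp at hk; omega
    exact accessible_of_row hx hxL hy hdL fun i _ _ => hrow i
  | succ k ih =>
    refine .step (ih (y := y + 1) (by omega) (by omega) (fun j h1 h2 => hcol j (by omega) h2)
      (by push_cast at hk ⊢; omega)) (by simp [NN]) (by rw [mem_box]; omega)
      (hcol _ le_rfl (by push_cast at hk; omega))

/-- A hole of `F` moves along a chain of sites of `F`. -/
theorem reach_hole_step (hR : Regime U₁ U₂ Δ) {F : Finset (ℤ × ℤ)} {z z' : ℤ × ℤ}
    (hF : z ∈ F) (hF' : z' ∈ F) (hb : z ∈ box L) (hb' : z' ∈ box L) (hn : NN z z') :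
    Reach U₁ U₂ Δ (hamiltonian U₁ U₂ Δ (cfg L F) - Δ + (2 * U₁ + 2 * U₂))
      (cfg L (F.erase z)) (cfg L (F.erase z')) := by
  have hne : z ≠ z' := by rintro rfl; simp [NN] at hn
  refine .single ⟨?_, ?_, ?_⟩
  · rw [hamiltonian_erase hF hb]; linarith [binding_le_full (L := L) hR F z]
  · rw [hamiltonian_erase hF' hb']; linarith [binding_le_full (L := L) hR F z']
  -- The hole goes from `z` to `z'` when the particle at `z'` jumps to `z`.
  · have e1 : F.erase z = insert z' ((F.erase z).erase z') :=
      (Finset.insert_erase (by simp [hF', hne.symm])).symm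
    have e2 : F.erase z' = insert z ((F.erase z).erase z') := by
      rw [Finset.erase_right_comm]
      exact (Finset.insert_erase (by simp [hF, hne])).symm
    rw [e1, e2]
    exact exists_swap hb' hb hn.symm (by simp) (by simp)

theorem reach_hole_column (hR : Regime U₁ U₂ Δ) {F : Finset (ℤ × ℤ)} {x c d : ℤ} (hcd : c ≤ d)
    (hF : ∀ j, c ≤ j → j ≤ d → (x, j) ∈ F ∧ (x, j) ∈ box L) :
    Reach U₁ U₂ Δ (hamiltonian U₁ U₂ Δ (cfg L F) - Δ + (2 * U₁ + 2 * U₂))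
      (cfg L (F.erase (x, c))) (cfg L (F.erase (x, d))) := by
  induction d, hcd using Int.leInduction with
  | base => exact .refl
  | succ k hk ih =>
    have h1 := hF k hk (by omega)
    have h2 := hF (k + 1) (by omega) le_rfl
    exact (ih fun j hj hj' => hF j hj (by omega)).trans
      (reach_hole_step hR h1.1 h2.1 h1.2 h2.2 (by simp [NN]))

theorem reach_hole_row (hR : Regime U₁ U₂ Δ) {F : Finset (ℤ × ℤ)} {a b y : ℤ} (hab : a ≤ b)
    (hF : ∀ i, a ≤ i → i ≤ b → (i, y) ∈ F ∧ (i, y) ∈ box L) :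
    Reach U₁ U₂ Δ (hamiltonian U₁ U₂ Δ (cfg L F) - Δ + (2 * U₁ + 2 * U₂))
      (cfg L (F.erase (a, y))) (cfg L (F.erase (b, y))) := by
  induction b, hab using Int.leInduction with
  | base => exact .refl
  | succ k hk ih =>
    have h1 := hF k hk (by omega)
    have h2 := hF (k + 1) (by omega) le_rfl
    exact (ih fun j hj hj' => hF j hj (by omega)).trans
      (reach_hole_step hR h1.1 h2.1 h1.2 h2.2 (by simp [NN]))

/-! ### Reduction of the energy -/

/-- A state of energy lower than `cfg L S` can be reached within an energy barrier `V`. -/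
def Reducible (U₁ U₂ Δ V : ℝ) (L : ℕ) (S : Finset (ℤ × ℤ)) : Prop :=
  ∃ S', Reach U₁ U₂ Δ (hamiltonian U₁ U₂ Δ (cfg L S) + V) (cfg L S) (cfg L S') ∧
    hamiltonian U₁ U₂ Δ (cfg L S') < hamiltonian U₁ U₂ Δ (cfg L S)

theorem reducible_of_fill (hR : Regime U₁ U₂ Δ) {S : Finset (ℤ × ℤ)} {z : ℤ × ℤ}
    (hz : Accessible L S z) (hb : Δ < binding U₁ U₂ L S z) :
    Reducible U₁ U₂ Δ (2 * Δ - U₁) L S := by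
  refine ⟨_, (hz.reach hR).1.mono ?_, ?_⟩
  · linarith [hR.eps_le, hR.U₂_pos]
  · rw [hamiltonian_insert hz.notMem.1 hz.notMem.2]
    linarith

theorem reach_erase (hR : Regime U₁ U₂ Δ) {S : Finset (ℤ × ℤ)} {z : ℤ × ℤ} (hS : z ∈ S)
    (hz : Accessible L (S.erase z) z) :
    Reach U₁ U₂ Δ (hamiltonian U₁ U₂ Δ (cfg L (S.erase z)) + Δ) (cfg L S)
      (cfg L (S.erase z)) := by
  have := (hz.reach hR).2
  rwa [Finset.insert_erase hS] at this

theorem reducible_of_erase (hR : Regime U₁ U₂ Δ) {S : Finset (ℤ × ℤ)} {z : ℤ × ℤ} (hS : z ∈ S)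
    (hz : Accessible L (S.erase z) z) (hb : binding U₁ U₂ L S z < Δ) :
    Reducible U₁ U₂ Δ (2 * Δ - U₁) L S := by
  have he := hamiltonian_erase (U₁ := U₁) (U₂ := U₂) (Δ := Δ) hS hz.notMem.2
  refine ⟨_, (reach_erase hR hS hz).mono ?_, ?_⟩
  · linarith [hR.eps_le, hR.U₂_pos]
  · linarith

theorem reducible_of_boundary (hR : Regime U₁ U₂ Δ) {S : Finset (ℤ × ℤ)} {z : ℤ × ℤ}
    (hS : z ∈ S) (hz : z ∈ innerBoundary L) : Reducible U₁ U₂ Δ (2 * Δ - U₁) L S := by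
  refine reducible_of_erase hR hS (.boundary hz (by simp)) ?_
  have : z ∉ interiorBox L := by simp [interiorBox, hz]
  rw [binding, if_neg this]
  linarith [hR.anisotropic, hR.eps_le, hR.U₂_pos]

/-! ### Maximal runs of integers -/

theorem exists_run_end {p : ℤ → Prop} {x M : ℤ} (hx : p x) (hM : ∀ i, M ≤ i → ¬ p i) :
    ∃ b, x ≤ b ∧ (∀ i, x ≤ i → i ≤ b → p i) ∧ ¬ p (b + 1) := by
  by_contra! h
  have key : ∀ b, x ≤ b → ∀ i, x ≤ i → i ≤ b → p i := by
    intro b hb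
    induction b, hb using Int.leInduction with
    | base => intro i h1 h2; obtain rfl : i = x := by omega
              exact hx
    | succ k hk ih =>
      intro i h1 h2
      rcases h2.lt_or_eq with h3 | rfl
      · exact ih i h1 (by omega)
      · exact h k hk ih
  exact hM (max x M) (le_max_right _ _) (key _ (le_max_left _ _) _ (le_max_left _ _) le_rfl)

theorem exists_run_start {p : ℤ → Prop} {x M : ℤ} (hx : p x) (hM : ∀ i, i ≤ M → ¬ p i) :
    ∃ a, a ≤ x ∧ (∀ i, a ≤ i → i ≤ x → p i) ∧ ¬ p (a - 1) := by
  obtain ⟨b, h1, h2, h3⟩ := exists_run_end (p := fun i => p (-i)) (x := -x) (M := -M)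
    (by simpa using hx) (fun i hi => hM _ (by omega))
  refine ⟨-b, by omega, fun i hi hi' => by simpa using h2 (-i) (by omega) (by omega), ?_⟩
  rwa [show -b - 1 = -(b + 1) by ring]

/-- In an interval where `p` is neither always true nor always false, it changes somewhere. -/
theorem exists_adjacent {p : ℤ → Prop} {a b u v : ℤ} (hu : a ≤ u ∧ u ≤ b) (hv : a ≤ v ∧ v ≤ b)
    (hpu : p u) (hpv : ¬ p v) :
    ∃ i s, (s = 1 ∨ s = -1) ∧ (a ≤ i ∧ i ≤ b) ∧ (a ≤ i + s ∧ i + s ≤ b) ∧ ¬ p i ∧ p (i + s) := by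
  rcases lt_or_ge u v with h | h
  · obtain ⟨c, h1, h2, h3⟩ := exists_run_end (p := fun i => i < v ∧ p i) (x := u) (M := v)
      ⟨h, hpu⟩ (fun i hi => by omega)
    have h4 := h2 c h1 le_rfl
    refine ⟨c + 1, -1, Or.inr rfl, by omega, by omega, ?_, by simpa using h4.2⟩
    rcases eq_or_ne (c + 1) v with h5 | h5
    · rwa [h5]
    · exact fun h6 => h3 ⟨by omega, h6⟩
  · obtain ⟨c, h1, h2, h3⟩ := exists_run_start (p := fun i => v < i ∧ p i) (x := u) (M := v)
      ⟨lt_of_le_of_ne h (by rintro rfl; exact hpv hpu), hpu⟩ (fun i hi => by omega)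
    have h4 := h2 c le_rfl h1
    refine ⟨c - 1, 1, Or.inl rfl, by omega, by omega, ?_, by simpa using h4.2⟩
    rcases eq_or_ne (c - 1) v with h5 | h5
    · rwa [h5]
    · exact fun h6 => h3 ⟨by omega, h6⟩

/-! ### Reductions near an empty row -/

/-- Otherwise the site just above the highest particle of the side column is open to the corridor in
row `d + 1` and has neighbours in both directions, so filling it gains energy. -/
theorem side_empty (hR : Regime U₁ U₂ Δ) {S : Finset (ℤ × ℤ)} (hS : S ⊆ interiorBox L)
    {c d m s : ℤ} (hs : s = 1 ∨ s = -1) (hd : ∀ x, (x, d + 1) ∉ S)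
    (hm : ∀ y, c ≤ y → y ≤ d → (m, y) ∈ S) (htop : (m + s, d) ∉ S)
    (hirr : ¬ Reducible U₁ U₂ Δ (2 * Δ - U₁) L S) :
    ∀ y, c - 1 ≤ y → y ≤ d → (m + s, y) ∉ S := by
  by_contra! h
  obtain ⟨y₀, h1, h2, h3⟩ := h
  -- The last height at or above which the column still has a particle is that of its highest
  -- particle.
  obtain ⟨y, h4, h5, h6⟩ := exists_run_end (p := fun y => y ≤ d ∧ ∃ j, y ≤ j ∧ j ≤ d ∧ (m + s, j) ∈ S)
    (x := y₀) (M := d + 1) ⟨h2, y₀, le_rfl, h2, h3⟩ (fun i hi h => by omega)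
  obtain ⟨h7, j, h8, h9, h10⟩ := h5 y h4 le_rfl
  have h11 : ∀ j, y + 1 ≤ j → j ≤ d → (m + s, j) ∉ S :=
    fun j h1 h2 h3 => h6 ⟨h1.trans h2, j, h1, h2, h3⟩
  obtain rfl : j = y := by
    by_contra hne
    exact h11 j (by omega) h9 h10
  have hlt : j < d := lt_of_le_of_ne h9 (by rintro rfl; exact htop h10)
  have i1 := mem_interiorBox.1 (hS h10)
  have hmS := hm (j + 1) (by omega) (by omega)
  have i2 := mem_interiorBox.1 (hS hmS)
  have i3 := mem_interiorBox.1 (hS (hm d (by omega) le_rfl))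
  refine hirr (reducible_of_fill hR (z := (m + s, j + 1)) (accessible_of_column (d := d)
    (by omega) (by omega) (by omega) (by omega) (by omega) hd h11) ?_)
  have hc := corner_le_binding (L := L) (S := S) hR (x := m + s) (y := j + 1) (s := -s) (t := -1)
    (by omega) (by omega) (mem_interiorBox.2 (by omega)) (by simpa using hmS)
    (by simpa using hS hmS) (by simpa using h10) (by simpa using hS h10)
  linarith [hR.eps_pos]

/-- The empty site below the rectangle may be enclosed, so it is not filled directly. The hole
travels up column `p` and along row `d` to the corner `(b, d)`, where a particle from outside fills
it. Since the filled configuration `F` has energy at most `H(S) - ε`, the moving hole stays below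
`H(S) + U₁ + U₂`, which is within the barrier because `2Δ - U₁ = U₁ + 2U₂ - 2ε`. -/
theorem reducible_of_hole (hR : Regime U₁ U₂ Δ) {S : Finset (ℤ × ℤ)} (hS : S ⊆ interiorBox L)
    {c d p s b : ℤ} (hcd : c ≤ d) (hs : s = 1 ∨ s = -1) (hd : ∀ x, (x, d + 1) ∉ S)
    (hp : (p, c - 1) ∉ S) (hps : (p + s, c - 1) ∈ S) (hcol : ∀ y, c ≤ y → y ≤ d → (p, y) ∈ S)
    (hpb : p ≤ b) (hrow : ∀ x, p ≤ x → x ≤ b → (x, d) ∈ S) (hb : (b + 1, d) ∉ S) :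
    Reducible U₁ U₂ Δ (2 * Δ - U₁) L S := by
  have i1 := mem_interiorBox.1 (hS hps)
  have i2 := mem_interiorBox.1 (hS (hcol c le_rfl hcd))
  have i3 := mem_interiorBox.1 (hS (hrow b hpb le_rfl))
  have hI : (p, c - 1) ∈ interiorBox L := mem_interiorBox.2 (by omega)
  have hbox := @interiorBox_subset_box L
  set F := insert (p, c - 1) S with hF
  have hFS : F.erase (p, c - 1) = S := Finset.erase_insert hp
  have hSF : S ⊆ F := Finset.subset_insert _ _
  have hH : hamiltonian U₁ U₂ Δ (cfg L F) = _ := hamiltonian_insert hp (hbox hI)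
  have hbind := corner_le_binding (L := L) (S := S) hR (x := p) (y := c - 1) (s := s) (t := 1) hs
    (by omega) hI hps (hS hps) (by simpa using hcol c le_rfl hcd)
    (by simpa using hS (hcol c le_rfl hcd))
  have hFd : ∀ x, (x, d + 1) ∉ F := fun x hx => by
    rw [hF, Finset.mem_insert, Prod.mk.injEq] at hx
    rcases hx with hx | hx
    · omega
    · exact hd x hx
  have hFb : (b + 1, d) ∉ F := fun hx => by
    rw [hF, Finset.mem_insert, Prod.mk.injEq] at hx
    rcases hx with hx | hx
    · omega
    · exact hb hx
  have hbF : (b, d) ∈ F := hSF (hrow b hpb le_rfl)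
  have r1 := reach_hole_column hR (F := F) (L := L) (x := p) (c := c - 1) (d := d) (by omega)
    (fun j h1 h2 => by
      rcases h1.lt_or_eq with h | rfl
      · exact ⟨hSF (hcol j (by omega) h2), hbox (hS (hcol j (by omega) h2))⟩
      · exact ⟨Finset.mem_insert_self _ _, hbox hI⟩)
  have r2 := reach_hole_row hR (F := F) (L := L) (y := d) hpb
    (fun j h1 h2 => ⟨hSF (hrow j h1 h2), hbox (hS (hrow j h1 h2))⟩)
  have hacc : Accessible L (F.erase (b, d)) (b, d) :=
    accessible_of_column (d := d) (by omega) (by omega) (by omega) (by omega) (by omega)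
      (fun x hx => hFd x (Finset.mem_of_mem_erase hx))
      (fun j h1 h2 => by obtain rfl : j = d := by omega
                         simp)
  have r3 := (hacc.reach hR).1
  rw [Finset.insert_erase hbF] at r3
  have hE := hamiltonian_erase (U₁ := U₁) (U₂ := U₂) (Δ := Δ) hbF hacc.notMem.2
  have hcorner := binding_le_corner (L := L) hR hFb (hFd b)
  rw [hFS] at r1
  refine ⟨F, (Reach.mono ?_ (r1.trans r2)).trans (r3.mono ?_), ?_⟩
  · linarith [hR.eps_le, hR.U₂_pos, hR.anisotropic]
  · linarith [hR.eps_le, hR.U₂_pos, hR.anisotropic]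
  · linarith [hR.eps_pos]

/-- Taken from the top, each particle but the last costs at most `ε`; the last has no vertical
neighbour and gains at least `Δ - U₁ = U₂ - ε`. As the accumulated cost before it is below `U₂ - ε`,
adding `Δ` for the departing particle stays below `2Δ - U₁`. -/
theorem reducible_of_remove_column (hR : Regime U₁ U₂ Δ) {S : Finset (ℤ × ℤ)}
    (hS : S ⊆ interiorBox L) {b c d : ℤ} (hcd : c ≤ d) (hd : ∀ x, (x, d + 1) ∉ S)
    (hcol : ∀ y, c ≤ y → y ≤ d → (b, y) ∈ S) (hside : ∀ y, c ≤ y → y ≤ d → (b + 1, y) ∉ S)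
    (hc : (b, c - 1) ∉ S) (hl : (U₁ + U₂ - Δ) * (d - c + 1) < U₂) :
    Reducible U₁ U₂ Δ (2 * Δ - U₁) L S := by
  -- `T y` is `S` with the part of column `b` above height `y` removed.
  set T : ℤ → Finset (ℤ × ℤ) :=
    fun y => S.filter (fun p => ¬ (p.1 = b ∧ y < p.2 ∧ p.2 ≤ d)) with hT
  have hTS : ∀ y, T y ⊆ S := fun y => Finset.filter_subset _ _
  have i1 := mem_interiorBox.1 (hS (hcol c le_rfl hcd))
  have i2 := mem_interiorBox.1 (hS (hcol d hcd le_rfl))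
  have hbox := @interiorBox_subset_box L
  have hmem : ∀ y, c ≤ y → y ≤ d → (b, y) ∈ T y := fun y h1 h2 => by
    simp [hT, hcol y h1 h2]
  have habove : ∀ y, c ≤ y → y ≤ d → (b, y + 1) ∉ T y := fun y h1 h2 h3 => by
    simp only [hT, Finset.mem_filter] at h3
    rcases h2.lt_or_eq with h | rfl
    · exact h3.2 ⟨trivial, lt_add_one y, h⟩
    · exact hd _ h3.1
  have hacc : ∀ y, c ≤ y → y ≤ d → Accessible L ((T y).erase (b, y)) (b, y) := fun y h1 h2 =>
    accessible_of_column (d := d) (by omega) (by omega) (by omega) (by omega) (by omega)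
      (fun x hx => hd x (hTS y (Finset.mem_of_mem_erase hx)))
      (fun j h3 h4 h5 => by
        simp only [hT, Finset.mem_erase, Finset.mem_filter, ne_eq, Prod.mk.injEq, true_and] at h5
        omega)
  have hTd : T d = S := Finset.filter_true_of_mem fun p _ => by omega
  have hstep : ∀ y, T (y - 1) = if y ≤ d then (T y).erase (b, y) else T (y - 1) := by
    intro y
    split_ifs with h
    · ext ⟨u, v⟩
      simp only [hT, Finset.mem_erase, Finset.mem_filter, ne_eq, Prod.mk.injEq]
      constructor
      · rintro ⟨h1, h2⟩; exact ⟨by omega, h1, by omega⟩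
      · rintro ⟨h1, h2, h3⟩; exact ⟨h2, by omega⟩
    · rfl
  have hε := hR.eps_pos
  have key : ∀ k : ℕ, c ≤ d - k →
      Reach U₁ U₂ Δ (hamiltonian U₁ U₂ Δ (cfg L S) + (2 * Δ - U₁)) (cfg L S) (cfg L (T (d - k))) ∧
      hamiltonian U₁ U₂ Δ (cfg L (T (d - k))) ≤
        hamiltonian U₁ U₂ Δ (cfg L S) + (U₁ + U₂ - Δ) * k := by
    intro k
    induction k with
    | zero => intro _; simp only [Nat.cast_zero, sub_zero, hTd]; exact ⟨.refl, by simp⟩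
    | succ k ih =>
      intro hk
      push_cast at hk ⊢
      obtain ⟨ih1, ih2⟩ := ih (by omega)
      have h1 := hmem (d - k) (by omega) (by omega)
      have h2 := hacc (d - k) (by omega) (by omega)
      have h3 := reach_erase hR h1 h2
      have h4 := hamiltonian_erase (U₁ := U₁) (U₂ := U₂) (Δ := Δ) h1 h2.notMem.2
      have h5 := binding_le_corner (L := L) hR (fun h => hside (d - k) (by omega) (by omega) (hTS _ h))
        (habove (d - k) (by omega) (by omega))
      have h6 := hstep (d - k)
      rw [if_pos (by omega)] at h6
      rw [show d - ((k : ℤ) + 1) = d - k - 1 by ring, h6]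
      have hkR : (c : ℝ) ≤ d - (k + 1) := by exact_mod_cast hk
      have h7 : (U₁ + U₂ - Δ) * (k + 1) ≤ (U₁ + U₂ - Δ) * (d - c) :=
        mul_le_mul_of_nonneg_left (by linarith) hε.le
      exact ⟨ih1.trans (h3.mono (by linarith)), by linarith⟩
  obtain ⟨k, hk⟩ := Int.eq_ofNat_of_zero_le (sub_nonneg.2 hcd)
  have hkc : d - (k : ℤ) = c := by omega
  obtain ⟨k1, k2⟩ := key k (by omega)
  rw [hkc] at k1 k2
  have hkR : (d : ℝ) - c = k := by exact_mod_cast hk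
  rw [hkR] at hl
  have h1 := hmem c le_rfl hcd
  have h2 := hacc c le_rfl hcd
  have h3 := reach_erase hR h1 h2
  have h4 := hamiltonian_erase (U₁ := U₁) (U₂ := U₂) (Δ := Δ) h1 h2.notMem.2
  have h5 := binding_le_horizontal (L := L) hR (fun h => hside c le_rfl hcd (hTS _ h))
    (habove c le_rfl hcd) (fun h => hc (hTS _ h))
  exact ⟨_, k1.trans (h3.mono (by linarith [hR.U₂_pos, hR.eps_le])), by linarith⟩

/-- The first particle costs at most `Δ - U₁`, and each later one gains at least `ε`. The barrier
`2Δ - U₁` is that of bringing in the second particle. Filling from the bottom keeps the column open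
above. -/
theorem reducible_of_add_column (hR : Regime U₁ U₂ Δ) {S : Finset (ℤ × ℤ)}
    (hS : S ⊆ interiorBox L) {x s c d : ℤ} (hs : s = 1 ∨ s = -1) (hcd : c ≤ d)
    (hd : ∀ x, (x, d + 1) ∉ S) (hx : 1 ≤ x ∧ x < L)
    (hcol : ∀ y, c ≤ y → y ≤ d → (x + s, y) ∈ S) (hside : ∀ y, c ≤ y → y ≤ d → (x, y) ∉ S)
    (hl : U₂ < (U₁ + U₂ - Δ) * (d - c + 1)) :
    Reducible U₁ U₂ Δ (2 * Δ - U₁) L S := by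
  set T : ℤ → Finset (ℤ × ℤ) := fun y => S ∪ {x} ×ˢ Finset.Icc c y with hT
  have hTS : ∀ y, S ⊆ T y := fun y => Finset.subset_union_left
  have i1 := mem_interiorBox.1 (hS (hcol c le_rfl hcd))
  have i2 := mem_interiorBox.1 (hS (hcol d hcd le_rfl))
  have hε := hR.eps_pos
  have hT0 : T c = insert (x, c) S := by
    ext p; simp [hT, Finset.mem_insert, or_comm]
  have hstep : ∀ y, c ≤ y → T (y + 1) = insert (x, y + 1) (T y) := by
    intro y hy
    ext ⟨u, v⟩
    simp only [hT, Finset.mem_union, Finset.mem_insert, Finset.mem_product, Finset.mem_singleton,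
      Finset.mem_Icc, Prod.mk.injEq]
    by_cases h : (u, v) ∈ S
    · simp [h]
    · simp only [h, false_or]; omega
  have key : ∀ y, c ≤ y → y ≤ d →
      Reach U₁ U₂ Δ (hamiltonian U₁ U₂ Δ (cfg L S) + (2 * Δ - U₁)) (cfg L S) (cfg L (T y)) ∧
      hamiltonian U₁ U₂ Δ (cfg L (T y)) ≤
        hamiltonian U₁ U₂ Δ (cfg L S) + (Δ - U₁) - (U₁ + U₂ - Δ) * (y - c) := by
    intro y hy
    induction y, hy using Int.leInduction with
    | base =>
      intro _
      have h2 : Accessible L S (x, c) :=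
        accessible_of_column (d := d) (by omega) (by omega) (by omega) (by omega) (by omega) hd
          (fun j h3 h4 => hside j h3 h4)
      have h3 := horizontal_le_binding' hR (L := L) (S := S) hs (mem_interiorBox.2 ⟨hx, i1.2⟩)
        (hcol c le_rfl hcd) (hS (hcol c le_rfl hcd))
      have h4 := hamiltonian_insert (U₁ := U₁) (U₂ := U₂) (Δ := Δ) h2.notMem.1 h2.notMem.2
      rw [hT0]
      exact ⟨(h2.reach hR).1.mono (by linarith [hR.U₂_pos, hR.eps_le]), by linarith⟩
    | succ y hy ih =>
      intro hyd
      obtain ⟨ih1, ih2⟩ := ih (by omega)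
      have i3 := mem_interiorBox.1 (hS (hcol y hy (by omega)))
      have h2 : Accessible L (T y) (x, y + 1) :=
        accessible_of_column (d := d) (by omega) (by omega) (by omega) (by omega) (by omega)
          (fun u hu => by
            simp only [hT, Finset.mem_union, Finset.mem_product, Finset.mem_Icc] at hu
            rcases hu with hu | hu
            · exact hd u hu
            · omega)
          (fun j h3 h4 hu => by
            simp only [hT, Finset.mem_union, Finset.mem_product, Finset.mem_Icc] at hu
            rcases hu with hu | hu
            · exact hside j (by omega) h4 hu
            · omega)
      have hm := hcol (y + 1) (by omega) hyd
      have h3 := corner_le_binding hR (L := L) (S := T y) (x := x) (y := y + 1) (t := -1) hs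
        (by omega) (mem_interiorBox.2 (by omega)) (hTS y hm) (hS hm)
        (by simp [hT, hy]) (mem_interiorBox.2 (by omega))
      have h4 := hamiltonian_insert (U₁ := U₁) (U₂ := U₂) (Δ := Δ) h2.notMem.1 h2.notMem.2
      rw [hstep y hy]
      have hyR : (c : ℝ) ≤ y := by exact_mod_cast hy
      have : 0 ≤ (U₁ + U₂ - Δ) * (y - c) := mul_nonneg hε.le (by linarith)
      push_cast
      exact ⟨ih1.trans ((h2.reach hR).1.mono (by linarith)), by linarith⟩
  obtain ⟨k1, k2⟩ := key d hcd le_rfl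
  exact ⟨_, k1, by linarith⟩

/-- The first particle has only a guaranteed vertical bond and costs at most `Δ - U₂`; bringing in
the second gives the barrier `2Δ - U₂`. Filling from right to left keeps the row open to the left
boundary. -/
theorem reducible_of_add_row (hR : Regime U₁ U₂ Δ) {S : Finset (ℤ × ℤ)} {e t : ℤ}
    (ht : t = 1 ∨ t = -1) (he : 1 ≤ e ∧ e < L) (het : 1 ≤ e + t ∧ e + t < L)
    (hrow : ∀ x : ℤ, 1 ≤ x → x < L → (x, e + t) ∈ S) (hempty : ∀ x, (x, e) ∉ S)
    (hl : U₁ < (U₁ + U₂ - Δ) * (L - 1)) : Reducible U₁ U₂ Δ (2 * Δ - U₂) L S := by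
  set T : ℕ → Finset (ℤ × ℤ) := fun k => S ∪ Finset.Icc ((L : ℤ) - 1 - k) (L - 1) ×ˢ {e} with hT
  have hTS : ∀ y, S ⊆ T y := fun y => Finset.subset_union_left
  have hε := hR.eps_pos
  have hΔ : Δ < U₁ + U₂ := by linarith
  have hT0 : T 0 = insert ((L : ℤ) - 1, e) S := by
    ext p; simp [hT, Finset.mem_insert, or_comm]
  have hstep : ∀ k : ℕ, T (k + 1) = insert ((L : ℤ) - 1 - (k + 1), e) (T k) := by
    intro k
    ext ⟨u, v⟩
    simp only [hT, Finset.mem_union, Finset.mem_insert, Finset.mem_product, Finset.mem_singleton,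
      Finset.mem_Icc, Prod.mk.injEq]
    by_cases h : (u, v) ∈ S
    · simp [h]
    · simp only [h, false_or]; push_cast; omega
  have key : ∀ k : ℕ, (k : ℤ) ≤ L - 2 →
      Reach U₁ U₂ Δ (hamiltonian U₁ U₂ Δ (cfg L S) + (2 * Δ - U₂)) (cfg L S) (cfg L (T k)) ∧
      hamiltonian U₁ U₂ Δ (cfg L (T k)) ≤
        hamiltonian U₁ U₂ Δ (cfg L S) + (Δ - U₂) - (U₁ + U₂ - Δ) * k := by
    intro k
    induction k with
    | zero =>
      intro _
      have h2 : Accessible L S ((L : ℤ) - 1, e) :=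
        accessible_of_row (by omega) (by omega) (by omega) (by omega) (fun i _ _ => hempty i)
      have hm := hrow (L - 1) (by omega) (by omega)
      have h3 := vertical_le_binding hR (L := L) (S := S) (x := (L : ℤ) - 1) ht
        (mem_interiorBox.2 (by omega)) hm (mem_interiorBox.2 (by omega))
      have h4 := hamiltonian_insert (U₁ := U₁) (U₂ := U₂) (Δ := Δ) h2.notMem.1 h2.notMem.2
      rw [hT0]
      push_cast
      exact ⟨(h2.reach hR).1.mono (by linarith [hR.U₂_pos, hR.eps_le, hR.anisotropic]),
        by linarith⟩
    | succ k ih =>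
      intro hk
      push_cast at hk
      obtain ⟨ih1, ih2⟩ := ih (by omega)
      have h2 : Accessible L (T k) ((L : ℤ) - 1 - (k + 1), e) :=
        accessible_of_row (by omega) (by omega) (by omega) (by omega)
          (fun i h0 h1 hu => by
            simp only [hT, Finset.mem_union, Finset.mem_product, Finset.mem_Icc] at hu
            rcases hu with hu | hu
            · exact hempty i hu
            · omega)
      have h3 := corner_le_binding hR (L := L) (S := T k) (x := (L : ℤ) - 1 - (k + 1)) (y := e)
        (s := 1) (t := t) (by omega) ht (mem_interiorBox.2 (by omega))
        (Finset.mem_union_right _ (by simp; omega)) (mem_interiorBox.2 (by omega))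
        (hTS k (hrow _ (by omega) (by omega))) (mem_interiorBox.2 (by omega))
      have h4 := hamiltonian_insert (U₁ := U₁) (U₂ := U₂) (Δ := Δ) h2.notMem.1 h2.notMem.2
      rw [hstep k]
      have : 0 ≤ (U₁ + U₂ - Δ) * k := mul_nonneg hε.le (by positivity)
      push_cast
      exact ⟨ih1.trans ((h2.reach hR).1.mono (by linarith)), by linarith⟩
  have hL : 2 ≤ L := by omega
  obtain ⟨k1, k2⟩ := key (L - 2) (by omega)
  rw [Nat.cast_sub hL] at k2
  push_cast at k2
  exact ⟨_, k1, by linarith⟩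

/-! ### Irreducible configurations are strips -/

theorem exists_strip_of_irreducible (hR : Regime U₁ U₂ Δ) {S : Finset (ℤ × ℤ)}
    (hS : S ⊆ interiorBox L) {l : ℕ} (hl : (U₁ + U₂ - Δ) * (l - 1) < U₂)
    (hl' : U₂ < (U₁ + U₂ - Δ) * l) {x₀ d : ℤ} (hx₀ : (x₀, d) ∈ S) (hd : ∀ x, (x, d + 1) ∉ S)
    (hirr : ¬ Reducible U₁ U₂ Δ (2 * Δ - U₁) L S) :
    ∃ c, c + l ≤ d + 1 ∧ (∀ y, c ≤ y → y ≤ d → ∀ x : ℤ, 1 ≤ x → x < L → (x, y) ∈ S) ∧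
      ∀ x, (x, c - 1) ∉ S := by
  have hmem : ∀ {x y : ℤ}, (x, y) ∈ S → (1 ≤ x ∧ x < L) ∧ 1 ≤ y ∧ y < L :=
    fun h => mem_interiorBox.1 (hS h)
  have hε := hR.eps_pos
  obtain ⟨b, hb1, hb2, hb3⟩ := exists_run_end (p := fun i => (i, d) ∈ S) (M := L) hx₀
    fun i hi h => by have := hmem h; omega
  obtain ⟨a, ha1, ha2, ha3⟩ := exists_run_start (p := fun i => (i, d) ∈ S) (M := 0) hx₀
    fun i hi h => by have := hmem h; omega
  have hab : ∀ i, a ≤ i → i ≤ b → (i, d) ∈ S := fun i h1 h2 =>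
    (le_total i x₀).elim (ha2 i h1) fun h => hb2 i h h2
  obtain ⟨c, hc1, hc2, hc3⟩ := exists_run_start
    (p := fun j => ∀ i, a ≤ i → i ≤ b → (i, j) ∈ S) (x := d) (M := 0) hab
    fun j hj h => by have := hmem (h x₀ ha1 hb1); omega
  have ia := hmem (hab a le_rfl (by omega))
  have ib := hmem (hab b (by omega) le_rfl)
  have ic := hmem (hc2 c le_rfl hc1 a le_rfl (by omega))
  have hright := side_empty hR hS (c := c) (Or.inl rfl) hd
    (fun y h1 h2 => hc2 y h1 h2 b (by omega) le_rfl) hb3 hirr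
  have hleft := side_empty hR hS (c := c) (Or.inr rfl) hd
    (fun y h1 h2 => hc2 y h1 h2 a le_rfl (by omega)) ha3 hirr
  have hbelow : ∀ x, a ≤ x → x ≤ b → (x, c - 1) ∉ S := by
    intro u hu1 hu2 hu3
    push Not at hc3
    obtain ⟨v, hv1, hv2, hv3⟩ := hc3
    -- By maximality of the rectangle row `c - 1` has a gap under it. If it also has a particle
    -- there, some gap is next to a particle.
    obtain ⟨i, s, hs, hi, his, h1, h2⟩ := exists_adjacent (p := fun i => (i, c - 1) ∈ S)
      (a := a) (b := b) ⟨hu1, hu2⟩ ⟨hv1, hv2⟩ hu3 hv3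
    exact hirr (reducible_of_hole hR hS hc1 hs hd h1 h2 (fun y h3 h4 => hc2 y h3 h4 i hi.1 hi.2)
      hi.2 (fun x h3 h4 => hab x (by omega) h4) hb3)
  have hlen : c + l ≤ d + 1 := by
    by_contra! hlt
    have h1 : (d : ℝ) - c + 1 ≤ l - 1 := by
      have : d - c + 1 ≤ (l : ℤ) - 1 := by omega
      exact_mod_cast this
    exact hirr (reducible_of_remove_column hR hS hc1 hd
      (fun y h1 h2 => hc2 y h1 h2 b (by omega) le_rfl)
      (fun y h1 h2 => hright y (by omega) h2) (hbelow b (by omega) le_rfl)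
      ((mul_le_mul_of_nonneg_left h1 hε.le).trans_lt hl))
  have hlong : U₂ < (U₁ + U₂ - Δ) * (d - c + 1) := by
    have h1 : (l : ℝ) ≤ d - c + 1 := by
      have : (l : ℤ) ≤ d - c + 1 := by omega
      exact_mod_cast this
    exact hl'.trans_le (mul_le_mul_of_nonneg_left h1 hε.le)
  have hbL : (L : ℤ) ≤ b + 1 := by
    by_contra! hlt
    exact hirr (reducible_of_add_column hR hS (x := b + 1) (s := -1) (Or.inr rfl) hc1 hd (by omega)
      (fun y h1 h2 => by simpa using hc2 y h1 h2 b (by omega) le_rfl)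
      (fun y h1 h2 => hright y (by omega) h2) hlong)
  have ha1' : a ≤ 1 := by
    by_contra! hlt
    exact hirr (reducible_of_add_column hR hS (x := a + -1) (s := 1) (Or.inl rfl) hc1 hd (by omega)
      (fun y h1 h2 => by simpa using hc2 y h1 h2 a le_rfl (by omega))
      (fun y h1 h2 => hleft y (by omega) h2) hlong)
  refine ⟨c, hlen, fun y h1 h2 x h3 h4 => hc2 y h1 h2 x (by omega) (by omega), fun x hx => ?_⟩
  have := hmem hx
  exact hbelow x (by omega) (by omega) hx

theorem cfg_eq_one_iff {S : Finset (ℤ × ℤ)} {x : Site L} : cfg L S x = 1 ↔ x.1 ∈ S := by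
  simp [cfg]

theorem cfg_eq_zero_iff {S : Finset (ℤ × ℤ)} {x : Site L} : cfg L S x = 0 ↔ x.1 ∉ S := by
  simp [cfg]

theorem isStripConfig_of_irreducible (hR : Regime U₁ U₂ Δ) {S : Finset (ℤ × ℤ)}
    (hS : S ⊆ box L) {l : ℕ} (hl : (U₁ + U₂ - Δ) * (l - 1) < U₂)
    (hl' : U₂ < (U₁ + U₂ - Δ) * l) (hirr : ¬ Reducible U₁ U₂ Δ (2 * Δ - U₁) L S) :
    IsStripConfig l (cfg L S) := by
  have hbd : ∀ z ∈ S, z ∉ innerBoundary L := fun z hz hb =>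
    hirr (reducible_of_boundary hR hz hb)
  have hSI : S ⊆ interiorBox L := fun z hz => Finset.mem_sdiff.2 ⟨hS hz, hbd z hz⟩
  have key : ∀ x y : ℤ, (x, y) ∈ S → ∃ c d : ℤ, c ≤ y ∧ y ≤ d ∧ c + l ≤ d + 1 ∧
      ∀ j, c ≤ j → j ≤ d → ∀ i : ℤ, 1 ≤ i → i < L → (i, j) ∈ S := by
    intro x y hxy
    -- Row `d` is the top of the run of nonempty rows starting at `y`. The strip found below row `d
    -- + 1` contains row `y`, because the row under the strip is empty.
    obtain ⟨d, hd1, hd2, hd3⟩ := exists_run_end (p := fun j => ∃ i, (i, j) ∈ S) (M := L)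
      ⟨x, hxy⟩ fun j hj ⟨i, hi⟩ => by have := mem_interiorBox.1 (hSI hi); omega
    push Not at hd3
    obtain ⟨x₀, hx₀⟩ := hd2 d hd1 le_rfl
    obtain ⟨c, hc1, hc2, hc3⟩ := exists_strip_of_irreducible hR hSI hl hl' hx₀ hd3 hirr
    refine ⟨c, d, ?_, hd1, hc1, hc2⟩
    by_contra! hlt
    obtain ⟨i, hi⟩ := hd2 (c - 1) (by omega) (by omega)
    exact hc3 i hi
  refine ⟨fun x hx => cfg_eq_zero_iff.2 fun h => hbd _ h hx, ?_, ?_⟩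
  · have hrow : ∀ x y : Site L, y.1 ∈ interiorBox L → x.1.2 = y.1.2 → x.1 ∈ S → y.1 ∈ S := by
      rintro ⟨⟨x1, x2⟩, hx⟩ ⟨⟨y1, y2⟩, hy⟩ hyI hxy h
      obtain rfl : x2 = y2 := hxy
      obtain ⟨c, d, h1, h2, -, h3⟩ := key x1 x2 h
      have := mem_interiorBox.1 hyI
      exact h3 x2 h1 h2 y1 this.1.1 this.1.2
    intro x y hx hy hxy
    simp only [cfg]
    exact if_congr ⟨hrow x y hy hxy, hrow y x hx hxy.symm⟩ rfl rfl
  · rintro ⟨⟨x1, x2⟩, hx⟩ h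
    rw [cfg_eq_one_iff] at h
    obtain ⟨c, d, h1, h2, h3, h4⟩ := key x1 x2 h
    have h5 := mem_interiorBox.1 (hSI h)
    have hpos : 0 < l := by
      rcases Nat.eq_zero_or_pos l with rfl | hpos
      · simp only [Nat.cast_zero, mul_zero] at hl'
        linarith [hR.U₂_pos]
      · exact hpos
    -- This start makes a window of `l` rows that contains `x2` and ends at row `max (c + l - 1)
    -- x2`, hence inside `[c, d]`.
    refine ⟨max c (x2 - l + 1), by simp only; omega, by simp only; omega, fun i hi hi' => ?_⟩
    have h6 := h4 i (by omega) (by omega) x1 h5.1.1 h5.1.2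
    exact ⟨⟨(x1, i), hS h6⟩, rfl, cfg_eq_one_iff.2 h6⟩

theorem reducible_of_isStripConfig (hR : Regime U₁ U₂ Δ) {S : Finset (ℤ × ℤ)}
    (hS : S ⊆ box L) {l : ℕ} (hstrip : IsStripConfig l (cfg L S))
    (hL : U₁ < (U₁ + U₂ - Δ) * (L - 1)) (h0 : cfg L S ≠ emptyConfig L)
    (h1 : cfg L S ≠ fullConfig L) : Reducible U₁ U₂ Δ (2 * Δ - U₂) L S := by
  obtain ⟨hs1, hs2, -⟩ := hstrip
  have hSI : S ⊆ interiorBox L := fun z hz => Finset.mem_sdiff.2 ⟨hS hz, fun hb =>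
    cfg_eq_zero_iff.1 (hs1 ⟨z, hS hz⟩ hb) hz⟩
  have hrow : ∀ x x' y : ℤ, (x, y) ∈ S → 1 ≤ x' → x' < L → (x', y) ∈ S := by
    intro x x' y h hx hx'
    have hI : (x', y) ∈ interiorBox L :=
      mem_interiorBox.2 ⟨⟨hx, hx'⟩, (mem_interiorBox.1 (hSI h)).2⟩
    have := hs2 ⟨(x, y), hS h⟩ ⟨(x', y), interiorBox_subset_box hI⟩ (hSI h) hI rfl
    exact cfg_eq_one_iff.1 (this.symm.trans (cfg_eq_one_iff.2 h))
  have hu : ∃ u v, (u, v) ∈ S := by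
    by_contra! h
    exact h0 (funext fun x => cfg_eq_zero_iff.2 (h x.1.1 x.1.2))
  have hv : ∃ u v, (u, v) ∈ interiorBox L ∧ (u, v) ∉ S := by
    by_contra! h
    refine h1 (funext fun x => ?_)
    simp only [cfg, fullConfig]
    exact if_congr ⟨fun hx => hSI hx, h x.1.1 x.1.2⟩ rfl rfl
  obtain ⟨u, y, huy⟩ := hu
  obtain ⟨v, y', hvI, hvy⟩ := hv
  have i1 := mem_interiorBox.1 (hSI huy)
  have i2 := mem_interiorBox.1 hvI
  obtain ⟨i, s, hs, hi, his, h2, h3⟩ := exists_adjacent (p := fun j => (1, j) ∈ S)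
    (a := 1) (b := L - 1) (u := y) (v := y') (by omega) (by omega)
    (hrow u 1 y huy le_rfl (by omega)) (fun h => hvy (hrow 1 v y' h i2.1.1 i2.1.2))
  exact reducible_of_add_row hR hs (by omega) (by omega)
    (fun x hx hx' => hrow 1 x _ h3 hx hx') (fun x hx => h2 (hrow x 1 i hx le_rfl (by omega))) hL

/-! ### From barriers to stability levels -/

theorem stabilityLevel_le {X : Type*} {P : X → X → ℝ} {H : X → ℝ} {η η' : X} {ω : List X}
    (hω : IsPath P ω η η') (hη : H η' < H η) :
    stabilityLevel P H η ≤ pathHeight H ω - (H η : EReal) :=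
  EReal.sub_le_sub (iInf₂_le_of_le η' hη (iInf₂_le ω hω)) le_rfl

theorem Reducible.exists_path (β : ℝ) {V : ℝ} (hV : 0 ≤ V) {S : Finset (ℤ × ℤ)}
    (h : Reducible U₁ U₂ Δ V L S) :
    ∃ (η' : Config L) (ω : List (Config L)),
      IsPath (transProb U₁ U₂ Δ β) ω (cfg L S) η' ∧
      hamiltonian U₁ U₂ Δ η' < hamiltonian U₁ U₂ Δ (cfg L S) ∧
      pathHeight (hamiltonian U₁ U₂ Δ) ω - (hamiltonian U₁ U₂ Δ (cfg L S) : EReal) ≤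
        (V : EReal) := by
  obtain ⟨S', h1, h2⟩ := h
  obtain ⟨ω, h3, h4⟩ := h1.exists_path β (by linarith)
  refine ⟨_, ω, h3, h2, ?_⟩
  refine (EReal.sub_le_sub h4 le_rfl).trans ?_
  rw [← EReal.coe_sub, EReal.coe_le_coe_iff]
  linarith

/-! ### The critical length and the critical energy -/

/-- Non-integrality of `U₂ / ε` makes the floor inequality strict, so columns of length `ℓ₂* - 1`
shrink and columns of length `ℓ₂*` grow. -/
theorem eps_mul_critLength (hε : 0 < eps U₁ U₂ Δ) (hU₂ : 0 < U₂)
    (hint : ∀ m : ℤ, U₂ / eps U₁ U₂ Δ ≠ m) :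
    eps U₁ U₂ Δ * (critLength U₁ U₂ Δ - 1) < U₂ ∧ U₂ < eps U₁ U₂ Δ * critLength U₁ U₂ Δ := by
  have h1 : (⌊U₂ / eps U₁ U₂ Δ⌋₊ : ℝ) < U₂ / eps U₁ U₂ Δ :=
    lt_of_le_of_ne (Nat.floor_le (by positivity))
      fun h => hint ⌊U₂ / eps U₁ U₂ Δ⌋₊ (by rw [← h]; simp)
  have h2 := Nat.lt_floor_add_one (U₂ / eps U₁ U₂ Δ)
  rw [lt_div_iff₀ hε] at h1
  rw [div_lt_iff₀ hε] at h2
  simp only [critLength]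
  push_cast
  constructor <;> linarith

theorem lt_critEnergy (hR : Regime U₁ U₂ Δ) (hint : ∀ m : ℤ, U₂ / eps U₁ U₂ Δ ≠ m) :
    2 * Δ - U₂ < critEnergy U₁ U₂ Δ := by
  have hε : 0 < eps U₁ U₂ Δ := hR.eps_pos
  have hεU : eps U₁ U₂ Δ ≤ U₂ / 100 := hR.eps_le
  have hU := hR.anisotropic
  have hU₂ := hR.U₂_pos
  obtain ⟨hl, hl'⟩ := eps_mul_critLength hε hU₂ hint
  have heps : eps U₁ U₂ Δ = U₁ + U₂ - Δ := rfl
  set l : ℝ := (critLength U₁ U₂ Δ : ℝ)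
  have hl2 : 2 < l := by
    by_contra! h
    nlinarith
  simp only [critEnergy, rectEnergy]
  set ε := eps U₁ U₂ Δ
  -- This positivity leaves `Γ > U₁ l - ε (l - 1) + Δ > U₁ l - U₂ + Δ`, and `U₁ l > 2 U₁ > Δ`.
  have h1 : 0 < (2 * l - 2) * (U₂ - ε * l + ε) :=
    mul_pos (by linarith) (by linarith)
  nlinarith [mul_pos (sub_pos.2 hl2) (sub_pos.2 hU)]

theorem exists_path_of_ne (hR : Regime U₁ U₂ Δ) (hint : ∀ m : ℤ, U₂ / eps U₁ U₂ Δ ≠ m)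
    (hL : U₁ < (U₁ + U₂ - Δ) * (L - 1)) (β : ℝ) {η : Config L} (h0 : η ≠ emptyConfig L)
    (h1 : η ≠ fullConfig L) :
    ∃ (η' : Config L) (ω : List (Config L)),
      IsPath (transProb U₁ U₂ Δ β) ω η η' ∧
      hamiltonian U₁ U₂ Δ η' < hamiltonian U₁ U₂ Δ η ∧
      stabilityLevel (transProb U₁ U₂ Δ β) (hamiltonian U₁ U₂ Δ) η ≤
        pathHeight (hamiltonian U₁ U₂ Δ) ω - (hamiltonian U₁ U₂ Δ η : EReal) ∧
      pathHeight (hamiltonian U₁ U₂ Δ) ω - (hamiltonian U₁ U₂ Δ η : EReal) ≤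
        ((2 * Δ - U₂ : ℝ) : EReal) ∧
      (¬ IsStripConfig (critLength U₁ U₂ Δ) η →
        pathHeight (hamiltonian U₁ U₂ Δ) ω - (hamiltonian U₁ U₂ Δ η : EReal) ≤
          ((2 * Δ - U₁ : ℝ) : EReal)) := by
  have hU := hR.anisotropic
  have hε := hR.eps_pos
  have hεU := hR.eps_le
  have hU₂ := hR.U₂_pos
  obtain ⟨hl, hl'⟩ := eps_mul_critLength hε hU₂ hint
  obtain ⟨S, hS, rfl⟩ := exists_cfg η
  by_cases hstrip : IsStripConfig (critLength U₁ U₂ Δ) (cfg L S)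
  · obtain ⟨η', ω, h2, h3, h4⟩ :=
      (reducible_of_isStripConfig hR hS hstrip hL h0 h1).exists_path β (by linarith)
    exact ⟨η', ω, h2, h3, stabilityLevel_le h2 h3, h4, fun h => absurd hstrip h⟩
  · have hred : Reducible U₁ U₂ Δ (2 * Δ - U₁) L S := by
      by_contra hirr
      exact hstrip (isStripConfig_of_irreducible hR hS hl hl' hirr)
    obtain ⟨η', ω, h2, h3, h4⟩ := hred.exists_path β (by linarith)
    exact ⟨η', ω, h2, h3, stabilityLevel_le h2 h3,
      h4.trans (EReal.coe_le_coe_iff.2 (by linarith)), fun _ => h4⟩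

end Kawasaki

end

theorem proposition3p7 (U₁ U₂ Δ : ℝ)
    (hU : 2 * U₂ < U₁)
    (hε : 0 < Kawasaki.eps U₁ U₂ Δ)
    (hεU : Kawasaki.eps U₁ U₂ Δ ≤ U₂ / 100)
    (hint : ∀ m : ℤ, U₂ / Kawasaki.eps U₁ U₂ Δ ≠ m) :
    2 * Δ - U₁ < Kawasaki.critEnergy U₁ U₂ Δ ∧
    2 * Δ - U₂ < Kawasaki.critEnergy U₁ U₂ Δ ∧
    ∃ L₀ : ℕ, ∀ L : ℕ, L₀ ≤ L → ∀ β : ℝ, 0 < β →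
      (Kawasaki.irreducibleStates (Kawasaki.transProb U₁ U₂ Δ β)
          (Kawasaki.hamiltonian U₁ U₂ Δ) (2 * Δ - U₂) ⊆
        {Kawasaki.emptyConfig L, Kawasaki.fullConfig L}) ∧
      (Kawasaki.irreducibleStates (Kawasaki.transProb U₁ U₂ Δ β)
          (Kawasaki.hamiltonian U₁ U₂ Δ) (2 * Δ - U₁) ⊆
        {Kawasaki.emptyConfig L, Kawasaki.fullConfig L} ∪
          {η | Kawasaki.IsStripConfig (Kawasaki.critLength U₁ U₂ Δ) η}) ∧
      ∀ η : Kawasaki.Config L, η ≠ Kawasaki.emptyConfig L → η ≠ Kawasaki.fullConfig L →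
        ∃ (η' : Kawasaki.Config L) (ω : List (Kawasaki.Config L)),
          Kawasaki.IsPath (Kawasaki.transProb U₁ U₂ Δ β) ω η η' ∧
          Kawasaki.hamiltonian U₁ U₂ Δ η' < Kawasaki.hamiltonian U₁ U₂ Δ η ∧
          Kawasaki.stabilityLevel (Kawasaki.transProb U₁ U₂ Δ β)
              (Kawasaki.hamiltonian U₁ U₂ Δ) η ≤
            Kawasaki.pathHeight (Kawasaki.hamiltonian U₁ U₂ Δ) ω -
              (Kawasaki.hamiltonian U₁ U₂ Δ η : EReal) ∧
          Kawasaki.pathHeight (Kawasaki.hamiltonian U₁ U₂ Δ) ω -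
              (Kawasaki.hamiltonian U₁ U₂ Δ η : EReal) ≤ ((2 * Δ - U₂ : ℝ) : EReal) ∧
          (¬ Kawasaki.IsStripConfig (Kawasaki.critLength U₁ U₂ Δ) η →
            Kawasaki.pathHeight (Kawasaki.hamiltonian U₁ U₂ Δ) ω -
              (Kawasaki.hamiltonian U₁ U₂ Δ η : EReal) ≤ ((2 * Δ - U₁ : ℝ) : EReal)) := by
  have hR : Kawasaki.Regime U₁ U₂ Δ := ⟨hU, hε, hεU⟩
  have hU₂ := hR.U₂_pos
  have heps : Kawasaki.eps U₁ U₂ Δ = U₁ + U₂ - Δ := rfl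
  have hΓ := Kawasaki.lt_critEnergy hR hint
  -- The choice of `L₀` makes filling a whole row, of `L - 1` sites, profitable: `U₁ < ε (L - 1)`.
  refine ⟨by linarith, hΓ, ⌈U₁ / Kawasaki.eps U₁ U₂ Δ⌉₊ + 2, fun L hL β _ => ?_⟩
  have hL' : U₁ < (U₁ + U₂ - Δ) * (L - 1) := by
    have h1 : U₁ / Kawasaki.eps U₁ U₂ Δ < L - 1 := by
      have h2 := Nat.le_ceil (U₁ / Kawasaki.eps U₁ U₂ Δ)
      have h3 : (⌈U₁ / Kawasaki.eps U₁ U₂ Δ⌉₊ : ℝ) + 2 ≤ L := by exact_mod_cast hL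
      linarith
    rw [div_lt_iff₀ hε] at h1
    rw [← heps]
    linarith
  have main := fun η h0 h1 => Kawasaki.exists_path_of_ne (η := η) hR hint hL' β h0 h1
  refine ⟨fun η hη => ?_, fun η hη => ?_, main⟩
  · by_contra hne
    simp only [Set.mem_insert_iff, Set.mem_singleton_iff, not_or] at hne
    obtain ⟨η', ω, -, -, h1, h2, -⟩ := main η hne.1 hne.2
    exact (lt_of_lt_of_le hη (h1.trans h2)).false
  · by_contra hne
    simp only [Set.mem_union, Set.mem_insert_iff, Set.mem_singleton_iff, not_or,
      Set.mem_ofPred_eq] at hne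
    obtain ⟨η', ω, -, -, h1, -, h2⟩ := main η hne.1.1 hne.1.2
    exact (lt_of_lt_of_le hη (h1.trans (h2 hne.2))).false
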